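/- Let $n$ be a positive integer, let $L_n=\{1,\dots,n\}$ with its usual order, and let $L_n\times_{\mathrm{lex}}\mathbb{Z}$ be the set $L_n\times\mathbb{Z}$ with the lexicographic order: $(i,k)\le(j,m)$ if and only if $i<j$, or $i=j$ and $k\le m$. Let $\mathcal{IO}_\infty(\mathbb{Z}^n_{\mathrm{lex}})$ be the semigroup, under composition of partial maps ($x(\alpha\beta)=(x\alpha)\beta$, defined whenever $x\in\operatorname{dom}\alpha$ and $x\alpha\in\operatorname{dom}\beta$), of all injective partial self-maps $\alpha$ of $L_n\times_{\mathrm{lex}}\mathbb{Z}$ which are monotone ($x\le y$ implies $x\alpha\le y\alpha$ for $x,y\in\operatorname{dom}\alpha$) and whose domain and range both have finite complement in $L_n\times\mathbb{Z}$. A topological semigroup is a Hausdorff topological space with a jointly continuous associative multiplication. It is $\Gamma$-compact if for every element $x$ the closure of $\{x,x^2,x^3,\dots\}$ is compact. It is a topological inverse semigroup if every $x$ has a unique $x^{-1}$ with $xx^{-1}x=x$ and $x^{-1}xx^{-1}=x^{-1}$, and $x\mapsto x^{-1}$ is continuous. A topological space is countably compact if every countable open cover has a finite subcover, and pseudocompact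 if every locally finite open cover is finite. Let $S$ be a topological semigroup which satisfies at least one of the following conditions: 1. $S$ is compact; 2. $S$ is $\Gamma$-compact; 3. $S\times S$ is countably compact; 4. $S$ is a countably compact topological inverse semigroup; 5. $S\times S$ is a Tychonoff pseudocompact space. Then $S$ does not contain the semigroup $\mathcal{IO}_\infty(\mathbb{Z}^n_{\mathrm{lex}})$; that is, there is no injective semigroup homomorphism from $\mathcal{IO}_\infty(\mathbb{Z}^n_{\mathrm{lex}})$ to $S$. -/

import Mathlib

/-- The set of all partial one-to-one transformations of `X` (partial bijections of `X`). -/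
def PartialInj (X : Type*) : Type _ := X ≃. X

namespace PartialInj

variable {X : Type*}

/-- `α.Maps x y` says that `x` lies in the domain of `α` and that `α` takes `x` to `y`. -/
def Maps (α : PartialInj X) (x y : X) : Prop := PEquiv.toFun α x = some y

/-- The domain of a partial injection. -/
def dom (α : PartialInj X) : Set X := {x | ∃ y, α.Maps x y}

/-- The range of a partial injection. -/
def ran (α : PartialInj X) : Set X := {y | ∃ x, α.Maps x y}

/-- The symmetric inverse monoid on `X`, maps being composed from left to right:
`x (α * β) = (x α) β`, see `maps_mul` below. -/
instance : Monoid (PartialInj X) where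
  mul α β := PEquiv.trans α β
  one := PEquiv.refl X
  mul_assoc α β γ := PEquiv.trans_assoc α β γ
  one_mul α := PEquiv.refl_trans α
  mul_one α := PEquiv.trans_refl α

theorem maps_one (x y : X) : (1 : PartialInj X).Maps x y ↔ x = y :=
  Option.some_inj

theorem maps_mul (α β : PartialInj X) (x z : X) :
    (α * β).Maps x z ↔ ∃ y, α.Maps x y ∧ β.Maps y z :=
  PEquiv.mem_trans α β x z |>.trans (by rfl)

theorem Maps.inj {α : PartialInj X} {x x' y : X} (h : α.Maps x y) (h' : α.Maps x' y) : x = x' :=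
  PEquiv.inj α h h'

theorem Maps.unique {α : PartialInj X} {x y y' : X} (h : α.Maps x y) (h' : α.Maps x y') :
    y = y' :=
  Option.some_inj.1 (h.symm.trans h')

/-- A partial injection is cofinite if its domain and its range have finite complements. -/
def IsCofinite (α : PartialInj X) : Prop := α.domᶜ.Finite ∧ α.ranᶜ.Finite

/-- A partial injection of an ordered set is monotone if it preserves the order on its domain. -/
def IsMonotone [LE X] (α : PartialInj X) : Prop :=
  ∀ x y x' y', α.Maps x x' → α.Maps y y' → x ≤ y → x' ≤ y'

theorem isCofinite_one : (1 : PartialInj X).IsCofinite := by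
  have h : (1 : PartialInj X).dom = Set.univ :=
    Set.eq_univ_of_forall fun x => ⟨x, (maps_one x x).2 rfl⟩
  have h' : (1 : PartialInj X).ran = Set.univ :=
    Set.eq_univ_of_forall fun x => ⟨x, (maps_one x x).2 rfl⟩
  simp [IsCofinite, h, h']

theorem IsCofinite.mul {α β : PartialInj X} (hα : α.IsCofinite) (hβ : β.IsCofinite) :
    (α * β).IsCofinite := by
  constructor
  · have hf : {x | ∃ y ∈ β.domᶜ, α.Maps x y}.Finite := by
      have := hβ.1.biUnion (t := fun y => {x | α.Maps x y})
        (fun y _ => Set.Subsingleton.finite fun x hx x' hx' => Maps.inj hx hx')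
      refine this.subset ?_
      rintro x ⟨y, hy, hxy⟩
      exact Set.mem_biUnion hy hxy
    refine (hα.1.union hf).subset fun x hx => ?_
    by_cases h : x ∈ α.dom
    · obtain ⟨y, hy⟩ := h
      refine Or.inr ⟨y, fun ⟨z, hz⟩ => hx ⟨z, (maps_mul α β x z).2 ⟨y, hy, hz⟩⟩, hy⟩
    · exact Or.inl h
  · have hf : {z | ∃ y ∈ α.ranᶜ, β.Maps y z}.Finite := by
      have := hα.2.biUnion (t := fun y => {z | β.Maps y z})
        (fun y _ => Set.Subsingleton.finite fun x hx x' hx' => Maps.unique hx hx')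
      refine this.subset ?_
      rintro x ⟨y, hy, hxy⟩
      exact Set.mem_biUnion hy hxy
    refine (hβ.2.union hf).subset fun z hz => ?_
    by_cases h : z ∈ β.ran
    · obtain ⟨y, hy⟩ := h
      refine Or.inr ⟨y, fun ⟨x, hx⟩ => hz ⟨x, (maps_mul α β x z).2 ⟨y, hx, hy⟩⟩, hy⟩
    · exact Or.inl h

end PartialInj

/-- The monoid of all monotone partial injections of `Lₙ ×_lex ℤ` with cofinite domain and
range, as a submonoid of the symmetric inverse monoid. Here `Lₙ` is the `n`-element chain
`Fin n` and `Fin n ×ₗ ℤ` carries the lexicographic order. -/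
def IOInfty (n : ℕ) : Submonoid (PartialInj (Fin n ×ₗ ℤ)) where
  carrier := {α | α.IsMonotone ∧ α.IsCofinite}
  one_mem' := by
    refine ⟨fun x y x' y' hx hy h => ?_, PartialInj.isCofinite_one⟩
    rw [PartialInj.maps_one] at hx hy
    exact hx ▸ hy ▸ h
  mul_mem' := by
    rintro α β ⟨hα, hα'⟩ ⟨hβ, hβ'⟩
    refine ⟨fun x y x' y' hx hy h => ?_, hα'.mul hβ'⟩
    obtain ⟨u, hu, hux⟩ := (PartialInj.maps_mul α β x x').1 hx
    obtain ⟨v, hv, hvy⟩ := (PartialInj.maps_mul α β y y').1 hy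
    exact hβ u v x' y' hux hvy (hα x y u v hu hv h)

/-- `S` contains a copy of `T` as a (purely algebraic) subsemigroup: there is an injective
semigroup homomorphism `T → S`. It need not preserve identity elements. -/
def ContainsSemigroup (S T : Type*) [Mul S] [Mul T] : Prop :=
  ∃ f : T →ₙ* S, Function.Injective f

/-- Positive powers in a semigroup: `posPow x k` is `x ^ (k + 1)`. -/
def posPow {S : Type*} [Mul S] (x : S) : ℕ → S
  | 0 => x
  | k + 1 => posPow x k * x

/-- A topological semigroup is `Γ`-compact if for every `x` the closure of
`{x, x², x³, …}` is compact. -/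
def IsGammaCompact (S : Type*) [TopologicalSpace S] [Mul S] : Prop :=
  ∀ x : S, IsCompact (closure (Set.range (posPow x)))

/-- `y` is an inverse of `x` in the sense of semigroup theory. -/
def IsSemigroupInverse {S : Type*} [Mul S] (x y : S) : Prop :=
  x * y * x = x ∧ y * x * y = y

/-- A topological semigroup is a topological inverse semigroup if every element has exactly one
inverse and the inversion is continuous. -/
def IsTopologicalInverseSemigroup (S : Type*) [TopologicalSpace S] [Mul S] : Prop :=
  (∀ x : S, ∃! y, IsSemigroupInverse x y) ∧
    ∃ inv : S → S, (∀ x, IsSemigroupInverse x (inv x)) ∧ Continuous inv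

/-- A topological space is pseudocompact if each locally finite open cover of it is finite
(a cover being a set of subsets). -/
def IsPseudocompact (X : Type*) [TopologicalSpace X] : Prop :=
  ∀ U : Set (Set X), (∀ u ∈ U, IsOpen u) → ⋃₀ U = Set.univ →
    LocallyFinite (fun u : U => (u : Set X)) → U.Finite

/-!
The shift `p` of all the non-negative halves `{i} × {0, 1, 2, …}` by one is a total order embedding
with cofinite range, so with its partial inverse `q` it satisfies `p * q = 1` and `q * p ≠ 1`.
Hence it suffices to show that a topological semigroup `S` as in the theorem contains no monoid
with such elements (equivalently, no copy of the bicyclic monoid):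
`not_containsSemigroup_of_mul_eq_one`.

Let `A n`, `B n`, `e`, `g` be the images in `S` of `p ^ n`, `q ^ n`, `1`, `q * p`. Then
`A n * B n = e`, and for `m < n` the product `A n * B m` is the image of a positive power of `p`,
so that it lies in the closed set `K = {s | s * g = s}`, which does not contain `e`. If `(x, y)` is
a cluster point of the sequence `(A n, B n)` in `S × S`, then `x * y = e` by continuity, while
also `x * y ∈ K`, because there are `m < n` with `A n` close to `x` and `B m` close to `y`: a
contradiction (`false_of_mapClusterPt`). Each of the first four conditions provides such a cluster
point; for a topological inverse semigroup, `B n` is the inverse of `A n`, so a cluster point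
of `A n` alone is enough.

If `S × S` is Tychonoff and pseudocompact, only sequences of nonempty open sets have cluster points
(`IsPseudocompact.exists_frequently_inter_nonempty`). Take a continuous `φ` that vanishes at `e` and
is `1` on `K`. By pseudocompactness the functions `u ↦ φ (u * v)`, `v ∈ S`, are equicontinuous,
and so are the functions `v ↦ φ (u * v)` (`IsPseudocompact.eventually_forall_dist_le`). Therefore
`A n` and `B m` can be replaced by open neighbourhoods `P n` and `Q m` with `φ (u * v)` uniformly
close to `φ (A n * B m)` for all `u ∈ P n`, `v ∈ Q m`, and the previous argument applies to a
cluster point of the open sets `P n ×ˢ Q n`.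
-/

open Filter Topology

/-! ### Pseudocompact spaces -/

/-- In a pseudocompact space a sequence of nonempty open sets is never locally finite. -/
theorem IsPseudocompact.exists_frequently_inter_nonempty {X : Type*} [TopologicalSpace X]
    (hX : IsPseudocompact X) (O : ℕ → Set X) (hO : ∀ n, IsOpen (O n))
    (hne : ∀ n, (O n).Nonempty) :
    ∃ x, ∀ N ∈ 𝓝 x, ∃ᶠ n in atTop, (O n ∩ N).Nonempty := by
  by_contra! h
  have hlf : LocallyFinite O := by
    intro x
    obtain ⟨N, hN, hfin⟩ := h x
    refine ⟨N, hN, ?_⟩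
    rw [← Nat.cofinite_eq_atTop, eventually_cofinite] at hfin
    simpa only [Set.nonempty_iff_ne_empty] using hfin
  -- A set that occurs infinitely often would violate local finiteness at any of its points.
  have hfib : ∀ u, {n | O n = u}.Finite := by
    intro u
    by_cases hu : ∃ n, O n = u
    · obtain ⟨n, rfl⟩ := hu
      obtain ⟨x, hx⟩ := hne n
      exact (hlf.point_finite x).subset fun m (hm : O m = O n) => show x ∈ O m from hm ▸ hx
    · exact Set.finite_empty.subset fun m hm => hu ⟨m, hm⟩
  have hU : (insert Set.univ (Set.range O)).Finite := by
    refine hX _ ?_ ?_ ?_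
    · rintro u (rfl | ⟨n, rfl⟩)
      exacts [isOpen_univ, hO n]
    · exact Set.sUnion_eq_univ_iff.2 fun x => ⟨_, Set.mem_insert _ _, Set.mem_univ x⟩
    · intro x
      obtain ⟨N, hN, hfin⟩ := hlf x
      refine ⟨N, hN, Set.Finite.of_finite_image (f := Subtype.val) ?_
        Subtype.val_injective.injOn⟩
      refine ((hfin.image O).insert Set.univ).subset ?_
      rintro _ ⟨⟨u, rfl | ⟨n, rfl⟩⟩, hu, rfl⟩
      exacts [Set.mem_insert _ _, Set.mem_insert_of_mem _ ⟨n, hu, rfl⟩]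
  have hR : (Set.range O).Finite := hU.subset (Set.subset_insert _ _)
  refine Set.infinite_univ (α := ℕ) ((hR.biUnion fun u _ => hfib u).subset fun n _ => ?_)
  exact Set.mem_biUnion (Set.mem_range_self n) rfl

/-- If `X × X` is pseudocompact, then the sections `F (·, v)` of a continuous function `F` on
`X × X` are equicontinuous (Frolík, Glicksberg).

Otherwise there are, at some `x`, open sets `U n`, `V n` and a decreasing sequence `W n` of
neighbourhoods of `x` containing `U n`, such that `F (u, v)` and `F (w, v)` are far apart for
`u ∈ U n`, `v ∈ V n` and `w ∈ W (n + 1)`. Since `U m ⊆ W (n + 1)` for `m > n`, this contradicts the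
continuity of `F` at a cluster point of the sets `U n ×ˢ V n`. -/
theorem IsPseudocompact.eventually_forall_dist_le {X : Type*} [TopologicalSpace X]
    (hX : IsPseudocompact (X × X)) {F : X × X → ℝ} (hF : Continuous F) (x : X) {ε : ℝ}
    (hε : 0 < ε) : ∀ᶠ u in 𝓝 x, ∀ v, dist (F (u, v)) (F (x, v)) ≤ ε := by
  by_contra hcon
  have step : ∀ W : {W // W ∈ 𝓝 x}, ∃ (U V : Set X) (W' : {W // W ∈ 𝓝 x}),
      IsOpen U ∧ U.Nonempty ∧ U ⊆ W.1 ∧ IsOpen V ∧ V.Nonempty ∧ W'.1 ⊆ W.1 ∧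
      ∀ u ∈ U, ∀ v ∈ V, ∀ w ∈ W'.1, ε < dist (F (u, v)) (F (w, v)) := by
    rintro ⟨W, hW⟩
    obtain ⟨u, huW, v, huv⟩ : ∃ u ∈ interior W, ∃ v, ε < dist (F (u, v)) (F (x, v)) := by
      by_contra! h
      exact hcon (mem_of_superset (interior_mem_nhds.2 hW) h)
    have hc : Continuous fun t : X × X × X => dist (F (t.1, t.2.1)) (F (t.2.2, t.2.1)) := by
      fun_prop
    have hev := (hc.tendsto (u, v, x)).eventually_const_lt huv
    rw [nhds_prod_eq, nhds_prod_eq] at hev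
    obtain ⟨U, hU, T, hT, hUT⟩ := mem_prod_iff.1 hev
    obtain ⟨V, hV, W', hW', hVW⟩ := mem_prod_iff.1 hT
    refine ⟨interior U ∩ interior W, interior V, ⟨W' ∩ W, inter_mem hW' hW⟩,
      isOpen_interior.inter isOpen_interior, ⟨u, mem_interior_iff_mem_nhds.2 hU, huW⟩,
      fun a ha => interior_subset ha.2, isOpen_interior, ⟨v, mem_interior_iff_mem_nhds.2 hV⟩,
      Set.inter_subset_right, fun a ha b hb w hw => ?_⟩
    exact hUT (show (a, b, w) ∈ U ×ˢ T from
      ⟨interior_subset ha.1, hVW ⟨interior_subset hb, hw.1⟩⟩)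
  choose U V W' hUo hUne hUW hVo hVne hW' hfar using step
  let W : ℕ → {W // W ∈ 𝓝 x} := fun n => Nat.rec ⟨Set.univ, univ_mem⟩ (fun _ => W') n
  have hanti : Antitone fun n => (W n).1 := antitone_nat_of_succ_le fun n => hW' (W n)
  obtain ⟨⟨a, b⟩, hab⟩ := hX.exists_frequently_inter_nonempty (fun n => U (W n) ×ˢ V (W n))
    (fun n => (hUo _).prod (hVo _)) (fun n => (hUne _).prod (hVne _))
  have hN : {z | dist (F z) (F (a, b)) < ε / 2} ∈ 𝓝 (a, b) :=
    hF.continuousAt.eventually (Metric.ball_mem_nhds _ (half_pos hε))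
  rw [nhds_prod_eq] at hN
  obtain ⟨M, hM, N, hNb, hMN⟩ := mem_prod_iff.1 hN
  have hfreq := hab (M ×ˢ N) (prod_mem_nhds hM hNb)
  obtain ⟨n, ⟨u, v⟩, ⟨hu, hv⟩, huM, hvN⟩ := hfreq.exists
  obtain ⟨m, hnm, ⟨w, v'⟩, ⟨hw, -⟩, hwM, -⟩ := frequently_atTop.1 hfreq (n + 1)
  have h1 := hfar _ u hu v hv w (hanti hnm (hUW _ hw))
  have h2 : dist (F (u, v)) (F (a, b)) < ε / 2 := hMN (show (u, v) ∈ M ×ˢ N from ⟨huM, hvN⟩)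
  have h3 : dist (F (w, v)) (F (a, b)) < ε / 2 := hMN (show (w, v) ∈ M ×ˢ N from ⟨hwM, hvN⟩)
  have h4 := dist_triangle_right (F (u, v)) (F (w, v)) (F (a, b))
  linarith

/-! ### Sequences of one-sided inverses in a topological semigroup -/

section

variable {S : Type*} [Mul S] [TopologicalSpace S] [T2Space S] [ContinuousMul S]
  {A B : ℕ → S} {e g : S}

theorem false_of_mapClusterPt (hAB : ∀ n, A n * B n = e)
    (hg : ∀ m n, m < n → A n * B m * g = A n * B m) (he : e * g ≠ e) {z : S × S}
    (hz : MapClusterPt z atTop fun n => (A n, B n)) : False := by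
  obtain ⟨x, y⟩ := z
  have hxy : x * y = e := by
    have hcl : IsClosed {z : S × S | z.1 * z.2 = e} := isClosed_eq (by fun_prop) continuous_const
    exact hcl.closure_subset (clusterPt_iff_forall_mem_closure.1 hz _
      (mem_map.2 (univ_mem' hAB)))
  have hop : ∀ᶠ z in 𝓝 (x, y), z.1 * z.2 * g ≠ z.1 * z.2 := by
    have hcl : IsOpen {z : S × S | z.1 * z.2 * g ≠ z.1 * z.2} :=
      isOpen_ne_fun (by fun_prop) (by fun_prop)
    exact hcl.mem_nhds (by simpa [hxy] using he)
  rw [nhds_prod_eq] at hop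
  obtain ⟨M, hM, N, hN, hMN⟩ := mem_prod_iff.1 hop
  have hfreq := mapClusterPt_iff_frequently.1 hz (M ×ˢ N) (prod_mem_nhds hM hN)
  obtain ⟨m, -, hm⟩ := hfreq.exists
  obtain ⟨n, hmn, hn, -⟩ := frequently_atTop.1 hfreq (m + 1)
  exact hMN (show (A n, B m) ∈ M ×ˢ N from ⟨hn, ‹_›⟩) (hg m n hmn)

theorem false_of_isPseudocompact_prod [CompletelyRegularSpace S] (hS : IsPseudocompact (S × S))
    (hAB : ∀ n, A n * B n = e)
    (hg : ∀ m n, m < n → A n * B m * g = A n * B m) (he : e * g ≠ e) : False := by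
  have hcl : IsClosed {s : S | s * g = s} := isClosed_eq (by fun_prop) continuous_id
  obtain ⟨ψ, hψ, hψe, hψK⟩ := CompletelyRegularSpace.completely_regular e _ hcl he
  let φ : S → ℝ := fun s => ψ s
  have hφ : Continuous φ := continuous_subtype_val.comp hψ
  have hφe : φ e = 0 := by simp [φ, hψe]
  have hφK : ∀ s, s * g = s → φ s = 1 := fun s hs => by simp [φ, hψK hs]
  have hP : ∀ n, ∃ P : Set S, A n ∈ P ∧ IsOpen P ∧
      ∀ u ∈ P, ∀ v, dist (φ (u * v)) (φ (A n * v)) ≤ 1 / 8 := fun n => by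
    obtain ⟨P, h, ho, hA⟩ := eventually_nhds_iff.1 (hS.eventually_forall_dist_le
      (F := fun z => φ (z.1 * z.2)) (by fun_prop) (A n) (by norm_num : (0 : ℝ) < 1 / 8))
    exact ⟨P, hA, ho, h⟩
  have hQ : ∀ n, ∃ Q : Set S, B n ∈ Q ∧ IsOpen Q ∧
      ∀ v ∈ Q, ∀ u, dist (φ (u * v)) (φ (u * B n)) ≤ 1 / 8 := fun n => by
    obtain ⟨Q, h, ho, hB⟩ := eventually_nhds_iff.1 (hS.eventually_forall_dist_le
      (F := fun z => φ (z.2 * z.1)) (by fun_prop) (B n) (by norm_num : (0 : ℝ) < 1 / 8))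
    exact ⟨Q, hB, ho, h⟩
  choose P hAP hPo hPd using hP
  choose Q hBQ hQo hQd using hQ
  have key : ∀ n m, ∀ u ∈ P n, ∀ v ∈ Q m, dist (φ (u * v)) (φ (A n * B m)) ≤ 1 / 4 := by
    intro n m u hu v hv
    have := dist_triangle (φ (u * v)) (φ (A n * v)) (φ (A n * B m))
    linarith [hPd n u hu v, hQd m v hv (A n)]
  obtain ⟨⟨x, y⟩, hxy⟩ := hS.exists_frequently_inter_nonempty (fun n => P n ×ˢ Q n)
    (fun n => (hPo n).prod (hQo n)) (fun n => ⟨(A n, B n), hAP n, hBQ n⟩)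
  have hN : {z : S × S | dist (φ (z.1 * z.2)) (φ (x * y)) < 1 / 4} ∈ 𝓝 (x, y) :=
    (show Continuous fun z : S × S => φ (z.1 * z.2) by fun_prop).continuousAt.eventually
      (Metric.ball_mem_nhds _ (by norm_num))
  rw [nhds_prod_eq] at hN
  obtain ⟨M, hM, N, hNy, hMN⟩ := mem_prod_iff.1 hN
  have hfreq := hxy (M ×ˢ N) (prod_mem_nhds hM hNy)
  obtain ⟨m, ⟨u, v⟩, ⟨hu, hv⟩, huM, hvN⟩ := hfreq.exists
  obtain ⟨n, hmn, ⟨w, v'⟩, ⟨hw, -⟩, hwM, -⟩ := frequently_atTop.1 hfreq (m + 1)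
  have h1 := key m m u hu v hv
  have h2 := key n m w hw v hv
  have h3 : dist (φ (u * v)) (φ (x * y)) < 1 / 4 := hMN (show (u, v) ∈ M ×ˢ N from ⟨huM, hvN⟩)
  have h4 : dist (φ (w * v)) (φ (x * y)) < 1 / 4 := hMN (show (w, v) ∈ M ×ˢ N from ⟨hwM, hvN⟩)
  rw [hAB, hφe] at h1
  rw [hφK _ (hg m n hmn)] at h2
  rw [Real.dist_eq, abs_le] at h1 h2
  rw [Real.dist_eq, abs_lt] at h3 h4
  linarith [h1.1, h1.2, h2.1, h2.2, h3.1, h3.2, h4.1, h4.2]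

end

/-! ### Monoids with a one-sided inverse -/

theorem map_pow_succ_eq_posPow {T S : Type*} [Monoid T] [Mul S] (f : T →ₙ* S) (t : T) (k : ℕ) :
    f (t ^ (k + 1)) = posPow (f t) k := by
  induction k with
  | zero => simp [posPow]
  | succ k ih => rw [pow_succ, map_mul, ih, posPow]

/-- If `p * q = 1` in a monoid, then `p ^ n * q ^ m` is a positive power of `p` for `m < n`, and
hence absorbs `q * p`. -/
theorem pow_mul_pow_mul_mul_of_lt {T : Type*} [Monoid T] {p q : T} (h : p * q = 1) {m n : ℕ}
    (hmn : m < n) : p ^ n * q ^ m * (q * p) = p ^ n * q ^ m := by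
  obtain ⟨k, rfl⟩ := Nat.exists_eq_add_of_lt hmn
  have h1 : p ^ (m + k + 1) * q ^ m = p ^ (k + 1) := by
    rw [show m + k + 1 = (k + 1) + m by omega, pow_add, mul_assoc, pow_mul_pow_eq_one m h, mul_one]
  rw [h1, pow_succ, mul_assoc, ← mul_assoc p q p, h, one_mul]

theorem not_containsSemigroup_of_mul_eq_one {T : Type*} [Monoid T] {p q : T} (hpq : p * q = 1)
    (hqp : q * p ≠ 1)
    (S : Type*) [Semigroup S] [TopologicalSpace S] [T2Space S] [ContinuousMul S]
    (hS : CompactSpace S ∨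
      IsGammaCompact S ∨
      CountablyCompactSpace (S × S) ∨
      (CountablyCompactSpace S ∧ IsTopologicalInverseSemigroup S) ∨
      (T35Space (S × S) ∧ IsPseudocompact (S × S))) :
    ¬ ContainsSemigroup S T := by
  rintro ⟨f, hf⟩
  -- The exponents start at `1`, as `f 1` need not be among the positive powers of `f p`.
  have hAB : ∀ n, f (p ^ (n + 1)) * f (q ^ (n + 1)) = f 1 := fun n => by
    rw [← map_mul, pow_mul_pow_eq_one _ hpq]
  have hg : ∀ m n, m < n →
      f (p ^ (n + 1)) * f (q ^ (m + 1)) * f (q * p) = f (p ^ (n + 1)) * f (q ^ (m + 1)) :=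
    fun m n hmn => by
      simp only [← map_mul]
      rw [pow_mul_pow_mul_mul_of_lt hpq (Nat.succ_lt_succ hmn)]
  have he : f 1 * f (q * p) ≠ f 1 := by
    rw [← map_mul, one_mul]
    exact fun h => hqp (hf h)
  have hΓ : IsGammaCompact S → False := fun h => by
    have hmem : ∀ t n, f (t ^ (n + 1)) ∈ closure (Set.range (posPow (f t))) := fun t n =>
      subset_closure ⟨n, (map_pow_succ_eq_posPow f t n).symm⟩
    obtain ⟨z, -, hz⟩ := ((h (f p)).prod (h (f q))).isCountablyCompact.seq_clusterPt
      (x := fun n => (f (p ^ (n + 1)), f (q ^ (n + 1))))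
      (Eventually.of_forall fun n => ⟨hmem p n, hmem q n⟩)
    exact false_of_mapClusterPt hAB hg he hz
  rcases hS with h | h | h | ⟨h, huniq, inv, hinv, hcont⟩ | ⟨h, hps⟩
  · exact hΓ fun x => isClosed_closure.isCompact
  · exact hΓ h
  · obtain ⟨z, -, hz⟩ := h.isCountablyCompact_univ.seq_clusterPt
      (x := fun n => (f (p ^ (n + 1)), f (q ^ (n + 1)))) (Eventually.of_forall fun n => trivial)
    exact false_of_mapClusterPt hAB hg he hz
  · obtain ⟨x, -, hx⟩ := h.isCountablyCompact_univ.seq_clusterPt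
      (x := fun n => f (p ^ (n + 1))) (Eventually.of_forall fun n => trivial)
    have hBinv : ∀ n, f (q ^ (n + 1)) = inv (f (p ^ (n + 1))) := fun n => by
      refine (huniq (f (p ^ (n + 1)))).unique ⟨?_, ?_⟩ (hinv _)
      · rw [hAB, ← map_mul, one_mul]
      · rw [mul_assoc, hAB, ← map_mul, mul_one]
    have hz := hx.continuousAt_comp (f := fun s => (s, inv s)) (by fun_prop)
    refine false_of_mapClusterPt hAB hg he (z := (x, inv x)) ?_
    simpa only [hBinv, Function.comp_def] using hz
  · have : IsInducing fun s : S => (s, s) :=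
      .of_comp (by fun_prop) continuous_fst .id
    have := this.completelyRegularSpace
    exact false_of_isPseudocompact_prod hps hAB hg he

/-! ### Partial injections from order embeddings -/

/-- An injective map as a total partial injection. -/
noncomputable def PartialInj.ofInjective {X : Type*} (s : X → X) (hs : Function.Injective s) :
    PartialInj X where
  toFun x := some (s x)
  invFun := Function.partialInv s
  inv x y := by simpa using hs.isPartialInv x y

/-- The inverse of `PartialInj.ofInjective`, defined on the range of `s`. -/
noncomputable def PartialInj.ofInjectiveInv {X : Type*} (s : X → X) (hs : Function.Injective s) :
    PartialInj X :=
  PEquiv.symm (PartialInj.ofInjective s hs)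

namespace PartialInj

variable {X : Type*} {s : X → X} (hs : Function.Injective s)

theorem maps_ofInjective (x y : X) : (ofInjective s hs).Maps x y ↔ s x = y :=
  Option.some_inj

theorem maps_ofInjectiveInv (x y : X) : (ofInjectiveInv s hs).Maps x y ↔ s y = x :=
  hs.isPartialInv y x

theorem ext_maps {α β : PartialInj X} (h : ∀ x y, α.Maps x y ↔ β.Maps x y) : α = β :=
  PEquiv.ext fun x => Option.ext fun y => h x y

theorem ofInjective_mul_ofInjectiveInv : ofInjective s hs * ofInjectiveInv s hs = 1 :=
  ext_maps fun x y => by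
    simp [maps_mul, maps_ofInjective, maps_ofInjectiveInv, maps_one, hs.eq_iff, eq_comm]

theorem ofInjectiveInv_mul_ofInjective_ne_one {x : X} (hx : x ∉ Set.range s) :
    ofInjectiveInv s hs * ofInjective s hs ≠ 1 := fun h => by
  obtain ⟨y, hy, -⟩ := (maps_mul _ _ x x).1 (h ▸ (maps_one x x).2 rfl)
  exact hx ⟨y, (maps_ofInjectiveInv hs x y).1 hy⟩

theorem isCofinite_ofInjective (hr : (Set.range s)ᶜ.Finite) : (ofInjective s hs).IsCofinite := by
  refine ⟨Set.finite_empty.subset fun x hx => hx ⟨s x, (maps_ofInjective hs _ _).2 rfl⟩,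
    hr.subset ?_⟩
  rintro y hy ⟨x, rfl⟩
  exact hy ⟨x, (maps_ofInjective hs _ _).2 rfl⟩

theorem isCofinite_ofInjectiveInv (hr : (Set.range s)ᶜ.Finite) :
    (ofInjectiveInv s hs).IsCofinite := by
  refine ⟨hr.subset ?_,
    Set.finite_empty.subset fun x hx => hx ⟨s x, (maps_ofInjectiveInv hs _ _).2 rfl⟩⟩
  rintro y hy ⟨x, rfl⟩
  exact hy ⟨x, (maps_ofInjectiveInv hs _ _).2 rfl⟩

theorem isMonotone_ofInjective [Preorder X] (hm : Monotone s) :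
    (ofInjective s hs).IsMonotone := fun x y x' y' hx hy h => by
  rw [maps_ofInjective] at hx hy
  exact hx ▸ hy ▸ hm h

theorem isMonotone_ofInjectiveInv [LinearOrder X] (hm : StrictMono s) :
    (ofInjectiveInv s hs).IsMonotone := fun x y x' y' hx hy h => by
  rw [maps_ofInjectiveInv] at hx hy
  subst hx hy
  exact hm.le_iff_le.1 h

end PartialInj

/-! ### The shift of the non-negative halves -/

/-- The self-map of `Lₙ ×_lex ℤ` that moves `(i, k)` with `0 ≤ k` to `(i, k + 1)` and fixes
`(i, k)` with `k < 0`; it misses exactly the points `(i, 0)`. -/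
def shiftNonneg (n : ℕ) (x : Fin n ×ₗ ℤ) : Fin n ×ₗ ℤ :=
  toLex ((ofLex x).1, if (ofLex x).2 < 0 then (ofLex x).2 else (ofLex x).2 + 1)

theorem strictMono_shiftNonneg (n : ℕ) : StrictMono (shiftNonneg n) := by
  intro x y h
  rw [Prod.Lex.lt_iff] at h ⊢
  refine h.imp id fun ⟨h1, h2⟩ => ⟨h1, ?_⟩
  simp only [shiftNonneg, ofLex_toLex]
  split_ifs <;> omega

theorem compl_range_shiftNonneg (n : ℕ) :
    (Set.range (shiftNonneg n))ᶜ = Set.range fun i : Fin n => toLex (i, (0 : ℤ)) := by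
  ext x
  obtain ⟨⟨i, k⟩, rfl⟩ := toLex.surjective x
  simp only [Set.mem_compl_iff, Set.mem_range, not_exists]
  constructor
  · intro h
    rcases lt_trichotomy k 0 with hk | rfl | hk
    · exact absurd (by simp [shiftNonneg, hk]) (h (toLex (i, k)))
    · exact ⟨i, rfl⟩
    · refine absurd ?_ (h (toLex (i, k - 1)))
      simp only [shiftNonneg, ofLex_toLex, if_neg (show ¬ k - 1 < 0 by omega), sub_add_cancel]
  · rintro ⟨j, hj⟩ y hy
    have h1 := congrArg (fun z => (ofLex z).2) hj
    have h2 := congrArg (fun z => (ofLex z).2) hy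
    simp only [shiftNonneg, ofLex_toLex] at h1 h2
    split_ifs at h2 <;> omega

theorem corollary4p8 (n : ℕ) (hn : 0 < n)
    (S : Type*) [Semigroup S] [TopologicalSpace S] [T2Space S] [ContinuousMul S]
    (hS : CompactSpace S ∨
      IsGammaCompact S ∨
      CountablyCompactSpace (S × S) ∨
      (CountablyCompactSpace S ∧ IsTopologicalInverseSemigroup S) ∨
      (T35Space (S × S) ∧ IsPseudocompact (S × S))) :
    ¬ ContainsSemigroup S (IOInfty n) := by
  have hm := strictMono_shiftNonneg n
  have hr : (Set.range (shiftNonneg n))ᶜ.Finite := by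
    rw [compl_range_shiftNonneg]
    exact Set.finite_range _
  have h0 : toLex ((⟨0, hn⟩ : Fin n), (0 : ℤ)) ∉ Set.range (shiftNonneg n) := by
    rw [← Set.mem_compl_iff, compl_range_shiftNonneg]
    exact ⟨_, rfl⟩
  let p : IOInfty n := ⟨PartialInj.ofInjective _ hm.injective,
    PartialInj.isMonotone_ofInjective _ hm.monotone, PartialInj.isCofinite_ofInjective _ hr⟩
  let q : IOInfty n := ⟨PartialInj.ofInjectiveInv _ hm.injective,
    PartialInj.isMonotone_ofInjectiveInv _ hm, PartialInj.isCofinite_ofInjectiveInv _ hr⟩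
  have hpq : p * q = 1 := Subtype.ext (PartialInj.ofInjective_mul_ofInjectiveInv hm.injective)
  have hqp : q * p ≠ 1 := fun h =>
    PartialInj.ofInjectiveInv_mul_ofInjective_ne_one hm.injective h0 (congrArg Subtype.val h)
  exact not_containsSemigroup_of_mul_eq_one hpq hqp S hS
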